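/- \textbf{Setting.} Let $X=(X_1,\dots,X_d)$ be real random variables on a probability space. Let $\pi_1,\dots,\pi_K$ be a partition of $\{1,\dots,d\}$ with $d_k:=|\pi_k|$, such that the random vectors $X_{\pi_1},\dots,X_{\pi_K}$ are mutually independent and the components of $X_{\pi_1}$ are mutually independent. ($\pi_1$ may be empty; for $k\ge 2$ the joint law of $X_{\pi_k}$ is arbitrary.) Let $\mathcal M:\mathbb R^d\to\mathbb R$ be measurable with $E[\mathcal M(X)^2]<\infty$ and $\Sigma:=\mathrm{Var}[\mathcal M(X)]>0$. \textbf{Shapley effect.} For every $j$, $$Sh_j:=\frac1{d\,\Sigma}\sum_{u\subseteq\{1,\dots,d\}\setminus\{j\}}\binom{d-1}{|u|}^{-1}\Big(\mathrm{Var}\,E[\mathcal M(X)\mid X_{u\cup\{j\}}]-\mathrm{Var}\,E[\mathcal M(X)\mid X_u]\Big).$$ \textbf{Dependency models.} Let $k\ge2$, $j\in\pi_k$ and $u\subseteq\pi_k\setminus\{j\}$. A dependency model of $X_{\pi_k}$ for $(u,j)$ consists of a permutation $w=(w_1,\dots,w_{d_k})$ of $\pi_k$ that lists first the elements of $u$ (in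 some order), then $j$, then the remaining elements; mutually independent real random variables $(Z_i)_{i\in\pi_k}$; and measurable functions $r_{w_2},\dots,r_{w_{d_k}}$, such that the vector $\tilde X_{\pi_k}=T(Z)$ defined recursively by $$\tilde X_{w_1}=Z_{w_1},\qquad \tilde X_{w_i}=r_{w_i}\big(\tilde X_{w_1},\dots,\tilde X_{w_{i-1}},Z_{w_i}\big)\quad(2\le i\le d_k)$$ has the same law as $X_{\pi_k}$. (So $Z_{w_1}$ has the law of $X_{w_1}$, and the other $Z_i$ are innovation variables.) Writing $X_{\sim\pi_k}$ for the inputs outside $\pi_k$, and taking $Z$ independent of $X_{\sim\pi_k}$, the associated equivalent representation of the output is $g_{u,j}(Z,X_{\sim\pi_k}):=\mathcal M(T(Z),X_{\sim\pi_k})$. Put $$\sigma^{fo}_{u,j}:=\mathrm{Var}\big(E[g_{u,j}\mid Z_j]-E[g_{u,j}]\big),\qquad \sigma^{tot}_{u,j}:=\mathrm{Var}\big(g_{u,j}-E_{Z_j}[g_{u,j}]\big),$$ where $E_{Z_j}$ is the expectation with respect to $Z_j$ alone, all other arguments of $g_{u,j}$ being fixed. For each $k\ge 2$, $j\in\pi_k$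 and $u\subseteq\pi_k\setminus\{j\}$, fix an arbitrary such dependency model. \textbf{Dependent sensitivity indices.} For $j\in\pi_1$, $$DS_j:=\frac{\mathrm{Var}\big(E[\mathcal M(X)\mid X_j]-E[\mathcal M(X)]\big)}{\Sigma},\qquad DS_{T_j}:=\frac{\mathrm{Var}\big(\mathcal M(X)-E_{X_j}[\mathcal M(X)]\big)}{\Sigma},$$ where $E_{X_j}$ is the expectation with respect to $X_j$ alone. For $j\in\pi_k$ with $k\ge2$, $$DS_j:=\frac1{d_k\Sigma}\sum_{u\subseteq\pi_k\setminus\{j\}}\binom{d_k-1}{|u|}^{-1}\sigma^{fo}_{u,j},\qquad DS_{T_j}:=\frac1{d_k\Sigma}\sum_{u\subseteq\pi_k\setminus\{j\}}\binom{d_k-1}{|u|}^{-1}\sigma^{tot}_{u,j}.$$ \textbf{Theorem.} For every input $j\in\{1,\dots,d\}$, $$DS_j\le Sh_j\le DS_{T_j}.$$ -/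

import Mathlib

open MeasureTheory ProbabilityTheory

noncomputable section

/-- The indices of the inputs that belong to the block `k`, for the partition of the `d` inputs
into `K` blocks encoded by the labelling `c` (input `i` lies in the block `c i`). -/
abbrev Block {d K : ℕ} (c : Fin d → Fin K) (k : Fin K) : Type := {i : Fin d // c i = k}

/-- The indices of the inputs that do not belong to the block `k`. -/
abbrev CoBlock {d K : ℕ} (c : Fin d → Fin K) (k : Fin K) : Type := {i : Fin d // c i ≠ k}

/-- The joint law of the inputs of the block `k`. -/
def blockLaw {Ω : Type*} [MeasurableSpace Ω] (μ : Measure Ω) {d K : ℕ} (X : Fin d → Ω → ℝ)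
    (c : Fin d → Fin K) (k : Fin K) : Measure (Block c k → ℝ) :=
  μ.map (fun ω (i : Block c k) => X i ω)

/-- The joint law of the inputs outside the block `k`. -/
def coBlockLaw {Ω : Type*} [MeasurableSpace Ω] (μ : Measure Ω) {d K : ℕ} (X : Fin d → Ω → ℝ)
    (c : Fin d → Fin K) (k : Fin K) : Measure (CoBlock c k → ℝ) :=
  μ.map (fun ω (i : CoBlock c k) => X i ω)

/-- The full input vector made of the values `a` on the block `k` and `b` outside it. -/
def assemble {d K : ℕ} (c : Fin d → Fin K) (k : Fin K) (a : Block c k → ℝ)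
    (b : CoBlock c k → ℝ) : Fin d → ℝ :=
  fun i => if h : c i = k then a ⟨i, h⟩ else b ⟨i, h⟩

/-- The ingredients of a dependency model for variables indexed by `ι`, for a permutation `w` of
`ι` of the form `w = (u, j, rest)`:
* `input i` is the law of the independent variable attached to `i`, namely of the innovation `Z_i`,
  or of the variable itself if `i` is first in the permutation;
* `r i` gives the variable `i` as a function of all the variables that come before it in the
  permutation and of its own innovation. The first variable is its own input. -/
structure DependencySystem (ι : Type) [Fintype ι] (u : Finset ι) (j : ι) where
  w : Fin (Fintype.card ι) ≃ ι
  mem_iff : ∀ i, i ∈ u ↔ w.symm i < w.symm j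
  input : ι → Measure ℝ
  isProbabilityMeasure_input : ∀ i, IsProbabilityMeasure (input i)
  r : (i : ι) → ({l : ι // w.symm l < w.symm i} → ℝ) × ℝ → ℝ
  measurable_r : ∀ i, Measurable (r i)
  r_first : ∀ i, (∀ l, w.symm i ≤ w.symm l) → ∀ x z, r i (x, z) = z

namespace DependencySystem

variable {ι : Type} [Fintype ι] {u : Finset ι} {j : ι}

/-- The vector generated from the independent inputs `z` by applying the functions `r` one after
the other, in the order of the permutation. -/
def represent (D : DependencySystem ι u j) (z : ι → ℝ) (i : ι) : ℝ :=
  D.r i (fun l => represent D z l.1, z i)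
termination_by D.w.symm i
decreasing_by exact l.2

end DependencySystem

/-- A dependency model, for a permutation `(u, j, rest)`, of a random vector with law `law`:
evaluated at independent inputs, the system generates a vector with exactly this law. -/
structure DependencyModel {ι : Type} [Fintype ι] (law : Measure (ι → ℝ)) (u : Finset ι) (j : ι)
    extends DependencySystem ι u j where
  map_represent : (Measure.pi input).map toDependencySystem.represent = law

namespace DependencyModel

variable {Ω : Type*} [MeasurableSpace Ω] {μ : Measure Ω} {d K : ℕ} {X : Fin d → Ω → ℝ}
  {c : Fin d → Fin K} {k : Fin K} {u : Finset (Block c k)} {j : Block c k}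

/-- The joint law of the arguments of the equivalent representation: the independent inputs of the
dependency model of the block `k`, and, independently, the inputs outside that block. -/
def argLaw (D : DependencyModel (blockLaw μ X c k) u j) :
    Measure ((Block c k → ℝ) × (CoBlock c k → ℝ)) :=
  (Measure.pi D.input).prod (coBlockLaw μ X c k)

/-- The equivalent representation `g_{u,j}` of the model output. -/
def equivRep (D : DependencyModel (blockLaw μ X c k) u j) (M : (Fin d → ℝ) → ℝ)
    (p : (Block c k → ℝ) × (CoBlock c k → ℝ)) : ℝ :=
  M (assemble c k (D.represent p.1) p.2)

/-- The first-order sensitivity functional `E[g | Z_j] - E[g]`. -/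
def foFunctional (D : DependencyModel (blockLaw μ X c k) u j) (M : (Fin d → ℝ) → ℝ)
    (p : (Block c k → ℝ) × (CoBlock c k → ℝ)) : ℝ :=
  (D.argLaw[D.equivRep M |
      MeasurableSpace.comap (fun q : (Block c k → ℝ) × (CoBlock c k → ℝ) => q.1 j)
        inferInstance]) p
    - ∫ q, D.equivRep M q ∂D.argLaw

/-- The total sensitivity functional `g - E_{Z_j}[g]`, where `E_{Z_j}` integrates over `Z_j` alone,
the other arguments of `g` being fixed. -/
def totFunctional (D : DependencyModel (blockLaw μ X c k) u j) (M : (Fin d → ℝ) → ℝ)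
    (p : (Block c k → ℝ) × (CoBlock c k → ℝ)) : ℝ :=
  D.equivRep M p - ∫ t, D.equivRep M (Function.update p.1 j t, p.2) ∂D.input j

/-- The variance of the first-order sensitivity functional. -/
def sigmaFo (D : DependencyModel (blockLaw μ X c k) u j) (M : (Fin d → ℝ) → ℝ) : ℝ :=
  variance (D.foFunctional M) D.argLaw

/-- The variance of the total sensitivity functional. -/
def sigmaTot (D : DependencyModel (blockLaw μ X c k) u j) (M : (Fin d → ℝ) → ℝ) : ℝ :=
  variance (D.totFunctional M) D.argLaw

end DependencyModel

/-- A choice, for every input `j` outside the block `0` and every subset `u` of its block with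
`j ∉ u`, of a dependency model of that block for a permutation that starts with the elements of `u`
(in some order) followed by `j`. -/
abbrev DependencyModels {Ω : Type*} [MeasurableSpace Ω] (μ : Measure Ω) {d K : ℕ} [NeZero K]
    (X : Fin d → Ω → ℝ) (c : Fin d → Fin K) : Type :=
  ∀ j : Fin d, c j ≠ 0 → ∀ u : {u : Finset (Block c (c j)) // (⟨j, rfl⟩ : Block c (c j)) ∉ u},
    DependencyModel (blockLaw μ X c (c j)) u.1 ⟨j, rfl⟩

section Indices

variable {Ω : Type*} [MeasurableSpace Ω] (μ : Measure Ω) {d K : ℕ} (X : Fin d → Ω → ℝ)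
  (M : (Fin d → ℝ) → ℝ)

/-- The model output `M(X)`. -/
def output (ω : Ω) : ℝ := M (fun i => X i ω)

/-- The conditional expectation `E[M(X) | X_u]`. -/
def condOutput (u : Finset (Fin d)) : Ω → ℝ :=
  μ[output X M | MeasurableSpace.comap (fun ω (i : u) => X i ω) inferInstance]

/-- The variance-based Shapley effect `Sh_j`. -/
def shapleyEffect (j : Fin d) : ℝ :=
  1 / (d * variance (output X M) μ) *
    ∑ u ∈ (Finset.univ.erase j).powerset, ((d - 1).choose u.card : ℝ)⁻¹ *
      (variance (condOutput μ X M (insert j u)) μ - variance (condOutput μ X M u) μ)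

variable [NeZero K] (c : Fin d → Fin K) (D : DependencyModels μ X c)

/-- The main dependent sensitivity index `DS_j`; the block `0` is the block of independent
inputs. -/
def mainDSI (j : Fin d) : ℝ :=
  if h : c j = 0 then
    variance (fun ω => condOutput μ X M {j} ω - ∫ ω', output X M ω' ∂μ) μ
      / variance (output X M) μ
  else
    1 / (Fintype.card (Block c (c j)) * variance (output X M) μ) *
      ∑ u : {u : Finset (Block c (c j)) // (⟨j, rfl⟩ : Block c (c j)) ∉ u},
        ((Fintype.card (Block c (c j)) - 1).choose u.1.card : ℝ)⁻¹ * (D j h u).sigmaFo M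

/-- The total dependent sensitivity index `DS_{T_j}`; the block `0` is the block of independent
inputs. -/
def totalDSI (j : Fin d) : ℝ :=
  if h : c j = 0 then
    variance (fun ω => output X M ω -
        ∫ t, M (Function.update (fun i => X i ω) j t) ∂(μ.map (X j))) μ
      / variance (output X M) μ
  else
    1 / (Fintype.card (Block c (c j)) * variance (output X M) μ) *
      ∑ u : {u : Finset (Block c (c j)) // (⟨j, rfl⟩ : Block c (c j)) ∉ u},
        ((Fintype.card (Block c (c j)) - 1).choose u.1.card : ℝ)⁻¹ * (D j h u).sigmaTot M

end Indices

end

/-! ### Conditional expectation, independence and variance for joins of σ-algebras. -/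

section SubSigmaAlgebras

/-! Each Shapley increment is sandwiched separately, by bounds that depend on the coalition `U` only
through its trace `u` on the block of `j`; averaging the bounds then gives the theorem.

The probabilistic core is `variance_condExp_sup_sub_mem`. If `Z` is independent of `C` and `B ≤ C`,
the increment `E[g | Z ⊔ B] - E[g | B]` projects onto `Z` as `E[g | Z] - E[g]`, and is itself the
projection of `g - E[g | C]` onto `Z ⊔ B`. Conditional expectation contracts variance, whence both
bounds. Here `Z` is generated by the innovation `Z_j`, `B` by the inputs in `U`, and `C` by all
arguments of the equivalent representation except `Z_j`.

The increment so bounded involves `σ(Z_j) ⊔ σ(X_U)`, whereas the Shapley effect involves `σ(X_{U ∪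
{j}})`. These σ-algebras may differ, as `Z_j` need not be recoverable from the inputs, but
`condExp_blockCoord_sup` shows that they give the output the same conditional expectation: once the
inputs up to `j` are known, the innovations that produced them are irrelevant to later inputs. Since
only the joint law of the inputs matters (`variance_condOutput`, `map_modelInput`), the increments
can be computed on the argument space.

Finally, `sum_shapleyWeight_block` collapses Shapley weights over all coalitions with a given trace
into the Shapley weights of the block. For the independent block, `X_j` plays the role of its own
innovation and the weights sum to one. -/

theorem isPiSystem_inter_measurableSet {Ω : Type*} (A B : MeasurableSpace Ω) :
    IsPiSystem {s | ∃ a b, MeasurableSet[A] a ∧ MeasurableSet[B] b ∧ a ∩ b = s} := by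
  rintro _ ⟨a, b, ha, hb, rfl⟩ _ ⟨a', b', ha', hb', rfl⟩ -
  exact ⟨a ∩ a', b ∩ b', ha.inter ha', hb.inter hb', Set.inter_inter_inter_comm ..⟩

theorem sup_eq_generateFrom_inter {Ω : Type*} (A B : MeasurableSpace Ω) :
    A ⊔ B = MeasurableSpace.generateFrom
      {s | ∃ a b, MeasurableSet[A] a ∧ MeasurableSet[B] b ∧ a ∩ b = s} := by
  apply le_antisymm
  · refine sup_le (fun s hs => ?_) (fun s hs => ?_)
    · exact MeasurableSpace.measurableSet_generateFrom
        ⟨s, Set.univ, hs, MeasurableSet.univ, Set.inter_univ s⟩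
    · exact MeasurableSpace.measurableSet_generateFrom
        ⟨Set.univ, s, MeasurableSet.univ, hs, Set.univ_inter s⟩
  · refine MeasurableSpace.generateFrom_le ?_
    rintro _ ⟨a, b, ha, hb, rfl⟩
    exact MeasurableSet.inter ((le_sup_left : A ≤ A ⊔ B) _ ha) ((le_sup_right : B ≤ A ⊔ B) _ hb)

variable {Ω : Type*} {mΩ : MeasurableSpace Ω} {μ : Measure Ω}

/-- A π-λ argument: the intersections form a π-system generating the join. The total integrals
needed for complements come from taking both sets to be the whole space. -/
theorem setIntegral_eq_of_forall_inter {A B : MeasurableSpace Ω} (hA : A ≤ mΩ) (hB : B ≤ mΩ)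
    {f g : Ω → ℝ} (hf : Integrable f μ) (hg : Integrable g μ)
    (h : ∀ a b, MeasurableSet[A] a → MeasurableSet[B] b →
      ∫ x in a ∩ b, f x ∂μ = ∫ x in a ∩ b, g x ∂μ)
    (s : Set Ω) (hs : MeasurableSet[A ⊔ B] s) : ∫ x in s, f x ∂μ = ∫ x in s, g x ∂μ := by
  have hle : A ⊔ B ≤ mΩ := sup_le hA hB
  have huniv : ∫ x, f x ∂μ = ∫ x, g x ∂μ := by
    simpa using h _ _ (@MeasurableSet.univ _ A) (@MeasurableSet.univ _ B)
  induction s, hs using MeasurableSpace.induction_on_inter (m := A ⊔ B)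
    (sup_eq_generateFrom_inter A B) (isPiSystem_inter_measurableSet A B) with
  | empty => simp
  | basic t ht =>
    obtain ⟨a, b, ha, hb, rfl⟩ := ht
    exact h a b ha hb
  | compl t ht ih =>
    rw [setIntegral_compl (hle _ ht) hf, setIntegral_compl (hle _ ht) hg, ih, huniv]
  | iUnion t hd ht ih =>
    rw [integral_iUnion (fun i => hle _ (ht i)) hd hf.integrableOn,
      integral_iUnion (fun i => hle _ (ht i)) hd hg.integrableOn]
    exact tsum_congr ih

variable [IsProbabilityMeasure μ]

/-- The two hypotheses factor the probability of `a ∩ b ∩ c` completely, and the sets `b ∩ c` form a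
π-system generating `B ⊔ C`. -/
theorem indep_sup_right {A B C : MeasurableSpace Ω} (hA : A ≤ mΩ) (hB : B ≤ mΩ) (hC : C ≤ mΩ)
    (hAB : Indep A B μ) (hABC : Indep (A ⊔ B) C μ) : Indep A (B ⊔ C) μ := by
  refine IndepSets.indep hA (sup_le hB hC) (@MeasurableSpace.isPiSystem_measurableSet _ A)
    (isPiSystem_inter_measurableSet B C) (@MeasurableSpace.generateFrom_measurableSet _ A).symm
    (sup_eq_generateFrom_inter B C) ?_
  rw [IndepSets_iff]
  rintro a _ ha ⟨b, c, hb, hc, rfl⟩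
  have h1 := (Indep_iff _ _ _).1 hABC (a ∩ b) c
    (MeasurableSet.inter ((le_sup_left : A ≤ A ⊔ B) _ ha) ((le_sup_right : B ≤ A ⊔ B) _ hb)) hc
  have h2 := (Indep_iff _ _ _).1 hABC b c ((le_sup_right : B ≤ A ⊔ B) _ hb) hc
  rw [← Set.inter_assoc, h1, h2, (Indep_iff _ _ _).1 hAB a b ha hb, mul_assoc]

/-- If conditioning on `D` reduces, on indicators of sets of `A`, to conditioning on the smaller
`A'`, then on `D`-measurable functions conditioning on `A` reduces to conditioning on `A'`, also in
presence of a further `C ≤ D`. -/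
theorem condExp_sup_eq_of_condExp_indicator {A A' C D : MeasurableSpace Ω} (hA : A ≤ mΩ)
    (hD : D ≤ mΩ) (hA'A : A' ≤ A) (hA'D : A' ≤ D) (hCD : C ≤ D)
    (hind : ∀ a, MeasurableSet[A] a →
      μ[a.indicator (fun _ => (1 : ℝ)) | D] =ᵐ[μ] μ[a.indicator (fun _ => (1 : ℝ)) | A'])
    {g : Ω → ℝ} (hg : StronglyMeasurable[D] g) (hgi : Integrable g μ) :
    μ[g | A ⊔ C] =ᵐ[μ] μ[g | A' ⊔ C] := by
  have hC : C ≤ mΩ := hCD.trans hD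
  have hA' : A' ≤ mΩ := hA'A.trans hA
  have hle : A ⊔ C ≤ mΩ := sup_le hA hC
  have hle' : A' ⊔ C ≤ mΩ := sup_le hA' hC
  -- Project `1_a f` onto `D`: the factor `f` comes out, and `E[1_a | D]` may be replaced by `E[1_a
  -- | A']`. This is used both for `g` and for `E[g | A' ⊔ C]`.
  have key : ∀ f : Ω → ℝ, StronglyMeasurable[D] f → Integrable f μ → ∀ a c,
      MeasurableSet[A] a → MeasurableSet[C] c →
      Integrable (μ[a.indicator (fun _ => (1 : ℝ)) | A'] * f) μ ∧
      ∫ x in a ∩ c, f x ∂μ = ∫ x in c, (μ[a.indicator (fun _ => (1 : ℝ)) | A'] * f) x ∂μ := by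
    intro f hf hfi a c ha hc
    have hmul : a.indicator (fun _ => (1 : ℝ)) * f = a.indicator f := by
      ext x; by_cases hx : x ∈ a <;> simp [hx]
    have hi : Integrable (a.indicator (fun _ => (1 : ℝ)) * f) μ := by
      rw [hmul]; exact hfi.indicator (hA _ ha)
    have hpull : μ[a.indicator (fun _ => (1 : ℝ)) * f | D] =ᵐ[μ]
        μ[a.indicator (fun _ => (1 : ℝ)) | A'] * f :=
      (condExp_mul_of_stronglyMeasurable_right hf hi
        ((integrable_const 1).indicator (hA _ ha))).trans ((hind a ha).mul (ae_eq_refl f))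
    refine ⟨integrable_condExp.congr hpull, ?_⟩
    rw [← setIntegral_congr_ae (hC _ hc) (hpull.mono fun x hx _ => hx),
      setIntegral_condExp hD hi (hCD _ hc), hmul, setIntegral_indicator (hA _ ha), Set.inter_comm]
  have hg' : StronglyMeasurable[A' ⊔ C] (μ[g | A' ⊔ C]) := stronglyMeasurable_condExp
  refine (ae_eq_condExp_of_forall_setIntegral_eq hle hgi
    (fun s _ _ => integrable_condExp.integrableOn) (fun s hs _ => ?_)
    (hg'.mono (sup_le_sup_right hA'A C)).aestronglyMeasurable).symm
  refine setIntegral_eq_of_forall_inter hA hC integrable_condExp hgi (fun a c ha hc => ?_) s hs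
  obtain ⟨hi1, h1⟩ := key g hg hgi a c ha hc
  obtain ⟨hi2, h2⟩ := key _ (hg'.mono (sup_le hA'D hCD)) integrable_condExp a c ha hc
  have hc' : MeasurableSet[A' ⊔ C] c := (le_sup_right : C ≤ A' ⊔ C) _ hc
  -- The factor `E[1_a | A']` is `A' ⊔ C`-measurable, so projecting its product with `g` onto `A' ⊔
  -- C` only replaces `g` by `E[g | A' ⊔ C]`.
  rw [h1, h2, ← setIntegral_condExp hle' hi1 hc']
  refine (setIntegral_congr_ae (hC _ hc) ?_).symm
  filter_upwards [condExp_mul_of_stronglyMeasurable_left (m := A' ⊔ C)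
    (stronglyMeasurable_condExp.mono (le_sup_left : A' ≤ A' ⊔ C)) hi1 hgi] with x hx _
  exact hx

theorem condExp_sup_of_indep {Z B C : MeasurableSpace Ω} (hZ : Z ≤ mΩ) (hC : C ≤ mΩ) (hBC : B ≤ C)
    (hind : Indep Z C μ) {g : Ω → ℝ} (hg : StronglyMeasurable[C] g) (hgi : Integrable g μ) :
    μ[g | Z ⊔ B] =ᵐ[μ] μ[g | B] := by
  have := condExp_sup_eq_of_condExp_indicator (μ := μ) (A' := ⊥) (C := B) hZ hC bot_le bot_le hBC
    (fun a ha => ?_) hg hgi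
  · rwa [bot_sup_eq] at this
  · rw [condExp_bot]
    exact condExp_indep_eq hZ hC (stronglyMeasurable_const.indicator ha) hind

/-- A Markov-type property: `g` sees `A` only through `A'`, and `C`, being independent of `A`, tells
nothing more about events of `A` once `A'` is known. It is applied with `A` the innovations up to
`j` and `A'` the inputs they generate. -/
theorem condExp_sup_eq_of_indep {A A' C C' : MeasurableSpace Ω} (hA : A ≤ mΩ) (hC : C ≤ mΩ)
    (hA'A : A' ≤ A) (hC'C : C' ≤ C) (hind : Indep A C μ) {g : Ω → ℝ}
    (hg : StronglyMeasurable[A' ⊔ C] g) (hgi : Integrable g μ) :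
    μ[g | A ⊔ C'] =ᵐ[μ] μ[g | A' ⊔ C'] := by
  refine condExp_sup_eq_of_condExp_indicator hA (sup_le (hA'A.trans hA) hC) hA'A le_sup_left
    (hC'C.trans le_sup_right) (fun a ha => ?_) hg hgi
  rw [sup_comm]
  exact condExp_sup_of_indep hC hA hA'A hind.symm (stronglyMeasurable_const.indicator ha)
    ((integrable_const 1).indicator (hA _ ha))

theorem variance_condExp_le {m : MeasurableSpace Ω} (hm : m ≤ mΩ) {g : Ω → ℝ} (hg : MemLp g 2 μ) :
    variance (μ[g | m]) μ ≤ variance g μ := by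
  rw [← integral_condVar_add_variance_condExp hm hg]
  refine le_add_of_nonneg_left (integral_nonneg_of_ae ?_)
  exact condExp_nonneg (.of_forall fun x => sq_nonneg _)

theorem variance_sub_condExp {m : MeasurableSpace Ω} (hm : m ≤ mΩ) {g : Ω → ℝ} (hg : MemLp g 2 μ) :
    variance (g - μ[g | m]) μ = variance g μ - variance (μ[g | m]) μ := by
  have hmean : ∫ x, (g - μ[g | m]) x ∂μ = 0 := by
    simp only [Pi.sub_apply]
    rw [integral_sub (hg.integrable one_le_two) integrable_condExp, integral_condExp hm, sub_self]
  rw [variance_of_integral_eq_zero (hg.sub (hg.condExp one_le_two)).aestronglyMeasurable.aemeasurable hmean,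
    ← integral_condVar_add_variance_condExp hm hg, add_sub_cancel_right, condVar,
    integral_condExp hm]
  rfl

/-- Removing independent information `Z` from a family `B ⊔ Z`: the loss of explained variance lies
between the variance explained by `Z` alone and the variance not explained by `C`, where `C`
contains `B` and is independent of `Z`. -/
theorem variance_condExp_sup_sub_mem {B C Z : MeasurableSpace Ω} (hZ : Z ≤ mΩ) (hC : C ≤ mΩ)
    (hBC : B ≤ C) (hind : Indep Z C μ) {g : Ω → ℝ} (hg : MemLp g 2 μ) :
    variance (μ[g | Z]) μ ≤ variance (μ[g | Z ⊔ B]) μ - variance (μ[g | B]) μ ∧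
    variance (μ[g | Z ⊔ B]) μ - variance (μ[g | B]) μ ≤ variance (g - μ[g | C]) μ := by
  have hB : B ≤ mΩ := hBC.trans hC
  have hS : Z ⊔ B ≤ mΩ := sup_le hZ hB
  have hgi : Integrable g μ := hg.integrable one_le_two
  have htower : μ[μ[g | Z ⊔ B] | B] =ᵐ[μ] μ[g | B] := condExp_condExp_of_le le_sup_right hS
  -- Pythagoras for nested projections turns the difference of variances into the variance of a
  -- difference.
  have hinc : variance (μ[g | Z ⊔ B] - μ[g | B]) μ =
      variance (μ[g | Z ⊔ B]) μ - variance (μ[g | B]) μ := by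
    rw [← variance_congr htower, ← variance_sub_condExp hB (hg.condExp one_le_two)]
    exact variance_congr ((ae_eq_refl _).sub htower.symm)
  rw [← hinc]
  constructor
  -- `E[g | B]` is independent of `Z`, so its projection onto `Z` is the constant mean of `g`.
  · have h1 : μ[μ[g | Z ⊔ B] - μ[g | B] | Z] =ᵐ[μ] fun x => (μ[g | Z]) x - ∫ y, g y ∂μ := by
      refine (condExp_sub integrable_condExp integrable_condExp Z).trans ?_
      refine Filter.EventuallyEq.sub (condExp_condExp_of_le le_sup_left hS) ?_
      refine (condExp_indep_eq hB hZ stronglyMeasurable_condExp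
        (indep_of_indep_of_le_right hind hBC).symm).trans ?_
      rw [integral_condExp hB]
    calc variance (μ[g | Z]) μ = variance (fun x => (μ[g | Z]) x - ∫ y, g y ∂μ) μ :=
          (variance_sub_const integrable_condExp.aestronglyMeasurable _).symm
      _ = variance (μ[μ[g | Z ⊔ B] - μ[g | B] | Z]) μ := (variance_congr h1).symm
      _ ≤ _ := variance_condExp_le hZ ((hg.condExp one_le_two).sub (hg.condExp one_le_two))
  -- For the `C`-measurable function `E[g | C]`, the independent `Z` adds nothing to `B`; the tower
  -- property then leaves `E[g | B]`.
  · have h1 : μ[g - μ[g | C] | Z ⊔ B] =ᵐ[μ] μ[g | Z ⊔ B] - μ[g | B] := by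
      refine (condExp_sub hgi integrable_condExp _).trans ?_
      refine (ae_eq_refl _).sub ?_
      exact (condExp_sup_of_indep hZ hC hBC hind stronglyMeasurable_condExp
        integrable_condExp).trans (condExp_condExp_of_le hBC hC)
    rw [← variance_congr h1]
    exact variance_condExp_le hS (hg.sub (hg.condExp one_le_two))

theorem condExp_map_comp {E : Type*} {m mE : MeasurableSpace E} {φ : Ω → E} (hφ : Measurable φ)
    (hm : m ≤ mE) {f : E → ℝ} (hf : Integrable f (μ.map φ)) :
    (μ.map φ)[f | m] ∘ φ =ᵐ[μ] μ[f ∘ φ | m.comap φ] := by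
  have : IsProbabilityMeasure (μ.map φ) := Measure.isProbabilityMeasure_map hφ.aemeasurable
  have hle : m.comap φ ≤ mΩ := (MeasurableSpace.comap_mono hm).trans hφ.comap_le
  have hc : Integrable ((μ.map φ)[f | m] ∘ φ) μ :=
    (integrable_map_measure integrable_condExp.aestronglyMeasurable hφ.aemeasurable).1
      integrable_condExp
  have hfi : Integrable (f ∘ φ) μ :=
    (integrable_map_measure hf.aestronglyMeasurable hφ.aemeasurable).1 hf
  refine ae_eq_condExp_of_forall_setIntegral_eq hle hfi (fun s _ _ => hc.integrableOn) ?_ ?_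
  · rintro _ ⟨t, ht, rfl⟩ -
    have h := setIntegral_condExp hm hf ht
    rwa [setIntegral_map (hm _ ht) integrable_condExp.aestronglyMeasurable hφ.aemeasurable,
      setIntegral_map (hm _ ht) hf.aestronglyMeasurable hφ.aemeasurable] at h
  · exact (stronglyMeasurable_condExp.comp_measurable
      (measurable_iff_comap_le.2 le_rfl)).aestronglyMeasurable

theorem variance_condExp_map {E : Type*} {m mE : MeasurableSpace E} {φ : Ω → E} (hφ : Measurable φ)
    (hm : m ≤ mE) {f : E → ℝ} (hf : Integrable f (μ.map φ)) :
    variance ((μ.map φ)[f | m]) (μ.map φ) = variance (μ[f ∘ φ | m.comap φ]) μ := by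
  rw [variance_map integrable_condExp.aestronglyMeasurable.aemeasurable hφ.aemeasurable]
  exact variance_congr (condExp_map_comp hφ hm hf)

/-- Independence makes the conditional law of `Z` given `Y` a constant kernel. This identifies the
integrals over a single argument in the total indices with conditional expectations given all the
others. -/
theorem condExp_eq_integral_of_indepFun {E : Type*} {mE : MeasurableSpace E} {Y : Ω → E}
    {Z : Ω → ℝ} (hY : Measurable Y) (hZ : Measurable Z) (hind : IndepFun Z Y μ) {Φ : E × ℝ → ℝ}
    (hΦ : Measurable Φ) (hi : Integrable (fun ω => Φ (Y ω, Z ω)) μ) :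
    μ[fun ω => Φ (Y ω, Z ω) | mE.comap Y] =ᵐ[μ] fun ω => ∫ t, Φ (Y ω, t) ∂(μ.map Z) := by
  have : IsProbabilityMeasure (μ.map Z) := Measure.isProbabilityMeasure_map hZ.aemeasurable
  have hcd : condDistrib Z Y μ =ᵐ[μ.map Y] Kernel.const E (μ.map Z) := by
    refine condDistrib_ae_eq_of_measure_eq_compProd Y hZ.aemeasurable ?_
    rw [Measure.compProd_const]
    exact hind.symm.map_prod_eq_prod_map_map hY.aemeasurable hZ.aemeasurable
  refine (condExp_prod_ae_eq_integral_condDistrib hY hZ.aemeasurable hΦ.stronglyMeasurable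
    hi).trans ?_
  filter_upwards [ae_of_ae_map hY.aemeasurable hcd] with ω hω
  rw [hω, Kernel.const_apply]

end SubSigmaAlgebras

/-! ### Combinatorics of the Shapley weights. -/

section ShapleyWeights

/-- The weight, among `n` players, of a coalition of `s` players in the Shapley value. -/
noncomputable def shapleyWeight (n s : ℕ) : ℝ := (n : ℝ)⁻¹ * ((n - 1).choose s : ℝ)⁻¹

theorem shapleyWeight_nonneg (n s : ℕ) : 0 ≤ shapleyWeight n s := by
  unfold shapleyWeight; positivity

/-- The weight equals `s! (n-1-s)! / n!`, the Beta integral of `t^s (1-t)^(n-1-s)` over `[0,1]`; the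
identity is `(1-t) + t = 1` under the integral, for a new player who stays out or joins. -/
theorem shapleyWeight_succ_add {n s : ℕ} (h : s < n) :
    shapleyWeight (n + 1) s + shapleyWeight (n + 1) (s + 1) = shapleyWeight n s := by
  obtain ⟨m, rfl⟩ : ∃ m, n = s + m + 1 := ⟨n - s - 1, by omega⟩
  have e1 : s + m + 1 + 1 - 1 = s + (m + 1) := by omega
  have e2 : s + m + 1 - 1 = s + m := by omega
  have e3 : s + (m + 1) = (s + 1) + m := by omega
  unfold shapleyWeight
  rw [e1, e2, Nat.cast_add_choose ℝ, Nat.cast_add_choose ℝ, e3, Nat.cast_add_choose ℝ,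
    show s + 1 + m = s + m + 1 by omega, Nat.factorial_succ (s + m), Nat.factorial_succ s,
    Nat.factorial_succ m]
  have h1 := Nat.cast_ne_zero (R := ℝ).2 (Nat.factorial_ne_zero s)
  have h2 := Nat.cast_ne_zero (R := ℝ).2 (Nat.factorial_ne_zero m)
  have h3 := Nat.cast_ne_zero (R := ℝ).2 (Nat.factorial_ne_zero (s + m))
  push_cast
  have h4 : (s : ℝ) + m + 1 ≠ 0 := by positivity
  have h5 : (s : ℝ) + m + 1 + 1 ≠ 0 := by positivity
  field_simp
  ring

theorem sum_powerset_shapleyWeight {α : Type*} [DecidableEq α] (T : Finset α) {n s : ℕ}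
    (h : s < n) : ∑ w ∈ T.powerset, shapleyWeight (n + T.card) (s + w.card) = shapleyWeight n s := by
  induction T using Finset.induction_on with
  | empty => simp
  | insert a T ha ih =>
    rw [Finset.sum_powerset_insert ha, ← Finset.sum_add_distrib, ← ih]
    refine Finset.sum_congr rfl fun w hw => ?_
    have hw' := Finset.mem_powerset.1 hw
    rw [Finset.card_insert_of_notMem ha, Finset.card_insert_of_notMem fun h' => ha (hw' h'),
      ← add_assoc, ← add_assoc]
    exact shapleyWeight_succ_add (by have := Finset.card_le_card hw'; omega)

theorem card_block_add_card_filter {d K : ℕ} (c : Fin d → Fin K) (k : Fin K) :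
    Fintype.card (Block c k) + (Finset.univ.filter fun i => c i ≠ k).card = d := by
  rw [Fintype.card_subtype, Finset.card_filter_add_card_filter_not, Finset.card_univ,
    Fintype.card_fin]

/-- Averaging, with Shapley weights, a function of the trace of the coalition on the block of `j`
amounts to averaging over the coalitions of that block. -/
theorem sum_shapleyWeight_block {d K : ℕ} (c : Fin d → Fin K) (j : Fin d)
    (F : Finset (Block c (c j)) → ℝ) :
    ∑ U ∈ (Finset.univ.erase j).powerset,
        shapleyWeight d U.card * F (U.subtype fun i => c i = c j) =
      ∑ v : {v : Finset (Block c (c j)) // (⟨j, rfl⟩ : Block c (c j)) ∉ v},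
        shapleyWeight (Fintype.card (Block c (c j))) v.1.card * F v.1 := by
  set T : Finset (Fin d) := Finset.univ.filter fun i => c i ≠ c j with hT
  have hd := card_block_add_card_filter c (c j)
  rw [← hT] at hd
  have hlt : ∀ v : {v : Finset (Block c (c j)) // (⟨j, rfl⟩ : Block c (c j)) ∉ v},
      v.1.card < Fintype.card (Block c (c j)) := fun v =>
    Finset.card_lt_univ_of_notMem v.2
  -- The block weight of `v` is spread over all coalitions `w` of inputs outside the block; the
  -- bijection `(v, w) ↦ v ∪ w` then recovers the sum over `U`.
  have hR : ∀ v : {v : Finset (Block c (c j)) // (⟨j, rfl⟩ : Block c (c j)) ∉ v},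
      shapleyWeight (Fintype.card (Block c (c j))) v.1.card * F v.1 =
      ∑ w ∈ T.powerset, shapleyWeight d (v.1.card + w.card) * F v.1 := by
    intro v
    rw [← Finset.sum_mul, ← sum_powerset_shapleyWeight T (hlt v), hd]
  rw [Finset.sum_congr rfl fun v _ => hR v, ← Finset.sum_product']
  have hdisj : ∀ (v : Finset (Block c (c j))) (w : Finset (Fin d)), w ⊆ T →
      Disjoint (v.map (Function.Embedding.subtype _)) w := by
    intro v w hw
    rw [Finset.disjoint_left]
    intro i hi hi'
    obtain ⟨a, _, rfl⟩ := Finset.mem_map.1 hi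
    exact (Finset.mem_filter.1 (hw hi')).2 a.2
  have hsub : ∀ (v : Finset (Block c (c j))) (w : Finset (Fin d)), w ⊆ T →
      (v.map (Function.Embedding.subtype _) ∪ w).subtype (fun i => c i = c j) = v := by
    intro v w hw
    ext a
    have ha : (a : Fin d) ∉ w := fun h => (Finset.mem_filter.1 (hw h)).2 a.2
    simp [ha, a.2]
  symm
  refine Finset.sum_bij' (fun p _ => p.1.1.map (Function.Embedding.subtype _) ∪ p.2)
    (fun U hU => (⟨U.subtype fun i => c i = c j, fun h => ?_⟩, U.filter fun i => c i ≠ c j))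
    ?_ ?_ ?_ ?_ ?_
  · exact Finset.notMem_erase j _ (Finset.mem_powerset.1 hU (Finset.mem_subtype.1 h))
  · rintro ⟨v, w⟩ hp
    have hw := Finset.mem_powerset.1 (Finset.mem_product.1 hp).2
    rw [Finset.mem_powerset]
    intro i hi
    refine Finset.mem_erase.2 ⟨?_, Finset.mem_univ _⟩
    rintro rfl
    rcases Finset.mem_union.1 hi with h | h
    · obtain ⟨a, ha, hai⟩ := Finset.mem_map.1 h
      exact v.2 (by convert ha; exact hai.symm)
    · exact (Finset.mem_filter.1 (hw h)).2 rfl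
  · intro U hU
    exact Finset.mem_product.2 ⟨Finset.mem_univ _,
      Finset.mem_powerset.2 (Finset.filter_subset_filter _ (Finset.subset_univ _))⟩
  · rintro ⟨v, w⟩ hp
    have hw := Finset.mem_powerset.1 (Finset.mem_product.1 hp).2
    refine Prod.ext (Subtype.ext (hsub v.1 w hw)) ?_
    ext i
    have hi : i ∈ w → c i ≠ c j := fun h => (Finset.mem_filter.1 (hw h)).2
    simp only [Finset.mem_filter, Finset.mem_union, Finset.mem_map,
      Function.Embedding.subtype_apply]
    constructor
    · rintro ⟨⟨a, _, rfl⟩ | h, hne⟩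
      · exact absurd a.2 hne
      · exact h
    · exact fun h => ⟨Or.inr h, hi h⟩
  · intro U hU
    ext i
    by_cases hi : c i = c j <;> simp [hi]
  · rintro ⟨v, w⟩ hp
    have hw := Finset.mem_powerset.1 (Finset.mem_product.1 hp).2
    rw [hsub v.1 w hw, Finset.card_union_of_disjoint (hdisj v.1 w hw), Finset.card_map]

theorem sum_shapleyWeight {d : ℕ} (j : Fin d) :
    ∑ U ∈ (Finset.univ.erase j).powerset, shapleyWeight d U.card = 1 := by
  -- Start from the one-player game, where the empty coalition has weight one, and add the `d - 1`
  -- inputs other than `j`.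
  have h := sum_powerset_shapleyWeight (Finset.univ.erase j) zero_lt_one
  rw [Finset.card_erase_of_mem (Finset.mem_univ j), Finset.card_univ, Fintype.card_fin,
    show 1 + (d - 1) = d by have := j.pos; omega] at h
  simpa [shapleyWeight] using h

end ShapleyWeights

/-! ### σ-algebras generated by subfamilies of real variables. -/

section FamilySigma

/-- The σ-algebra generated by the real functions `f i`, for `i ∈ S`. -/
def familySigma {Ω ι : Type*} (f : ι → Ω → ℝ) (S : Set ι) : MeasurableSpace Ω :=
  ⨆ i ∈ S, MeasurableSpace.comap (f i) inferInstance

variable {Ω ι : Type*} {f : ι → Ω → ℝ} {S T : Set ι}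

theorem familySigma_le_iff {m : MeasurableSpace Ω} :
    familySigma f S ≤ m ↔ ∀ i ∈ S, Measurable[m] (f i) := by
  simp only [familySigma, iSup₂_le_iff, measurable_iff_comap_le]

theorem measurable_familySigma {i : ι} (hi : i ∈ S) : Measurable[familySigma f S] (f i) :=
  familySigma_le_iff.1 le_rfl i hi

theorem measurable_of_familySigma_le {m : MeasurableSpace Ω} (h : familySigma f S ≤ m) {i : ι}
    (hi : i ∈ S) : Measurable[m] (f i) :=
  familySigma_le_iff.1 h i hi

theorem familySigma_mono (h : S ⊆ T) : familySigma f S ≤ familySigma f T :=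
  familySigma_le_iff.2 fun _ hi => measurable_familySigma (h hi)

theorem familySigma_insert (a : ι) :
    familySigma f (insert a S) = MeasurableSpace.comap (f a) inferInstance ⊔ familySigma f S :=
  iSup_insert

theorem familySigma_singleton (a : ι) :
    familySigma f {a} = MeasurableSpace.comap (f a) inferInstance :=
  iSup_singleton

theorem comap_familySigma {Ω' : Type*} (φ : Ω' → Ω) :
    (familySigma f S).comap φ = familySigma (fun i => f i ∘ φ) S := by
  simp only [familySigma, MeasurableSpace.comap_iSup, MeasurableSpace.comap_comp]

theorem familySigma_le_comap : familySigma f S ≤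
    MeasurableSpace.comap (fun ω i => f i ω) inferInstance := by
  refine familySigma_le_iff.2 fun i _ => ?_
  have h : Measurable fun x : ι → ℝ => x i := measurable_pi_apply i
  exact h.comp (measurable_iff_comap_le.2 le_rfl)

theorem comap_subtype_eq_familySigma (u : Finset ι) :
    MeasurableSpace.comap (fun ω (i : u) => f i ω) inferInstance = familySigma f ↑u := by
  apply le_antisymm
  · refine measurable_iff_comap_le.1 ?_
    exact @measurable_pi_lambda Ω u (fun _ => ℝ) (familySigma f ↑u) (fun _ => inferInstance) _
      fun i => measurable_familySigma (Finset.mem_coe.2 i.2)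
  · refine familySigma_le_iff.2 fun i hi => ?_
    have h : Measurable fun x : u → ℝ => x ⟨i, hi⟩ := measurable_pi_apply _
    exact h.comp (measurable_iff_comap_le.2 le_rfl)

theorem indep_familySigma_compl_sup {mΩ : MeasurableSpace Ω} {μ : Measure Ω}
    [IsProbabilityMeasure μ] (hf : ∀ i, Measurable (f i)) (hind : iIndepFun f μ)
    {m : MeasurableSpace Ω} (hm : m ≤ mΩ) (hindm : Indep (familySigma f Set.univ) m μ)
    (S : Set ι) : Indep (familySigma f S) (familySigma f Sᶜ ⊔ m) μ := by
  refine indep_sup_right (familySigma_le_iff.2 fun i _ => hf i)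
    (familySigma_le_iff.2 fun i _ => hf i) hm ?_ ?_
  · exact indep_iSup_of_disjoint (fun i => (hf i).comap_le) ((iIndepFun_iff_iIndep _ _ _).1 hind)
      disjoint_compl_right
  · exact indep_of_indep_of_le_left hindm
      (sup_le (familySigma_mono (Set.subset_univ _)) (familySigma_mono (Set.subset_univ _)))

end FamilySigma

/-- The recursion can be stopped at any variable whose generated value is already measurable;
elsewhere the innovation is needed. Allowing either alternative for each predecessor covers
generation from innovations alone and generation of late variables from early values and later
innovations. -/
theorem DependencySystem.measurable_represent_comp {ι : Type} [Fintype ι] {u : Finset ι} {j : ι}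
    (D : DependencySystem ι u j) {Ω : Type*} {m : MeasurableSpace Ω} {z : Ω → ι → ℝ} (i : ι)
    (h : ∀ l, D.w.symm l ≤ D.w.symm i →
      Measurable (fun ω => D.represent (z ω) l) ∨ Measurable (fun ω => z ω l)) :
    Measurable (fun ω => D.represent (z ω) i) := by
  induction hn : D.w.symm i using WellFoundedLT.induction generalizing i with
  | ind n ih =>
    subst hn
    rcases h i le_rfl with hi | hi
    · exact hi
    · have : (fun ω => D.represent (z ω) i) =
          fun ω => D.r i (fun l => D.represent (z ω) l.1, z ω i) := by
        funext ω; rw [DependencySystem.represent]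
      rw [this]
      refine (D.measurable_r i).comp (Measurable.prodMk (measurable_pi_lambda _ fun l => ?_) hi)
      exact ih _ l.2 l.1 (fun l' hl' => h l' (hl'.trans l.2.le)) rfl

/-! ### Splitting the inputs into a block and its complement; transfer to another input vector with
the same law. -/

section Blocks

variable {d K : ℕ} (c : Fin d → Fin K) (k : Fin K)

theorem measurable_assemble_comp {Ω : Type*} {m : MeasurableSpace Ω} {a : Ω → Block c k → ℝ}
    {b : Ω → CoBlock c k → ℝ} (i : Fin d)
    (ha : ∀ h : c i = k, Measurable fun ω => a ω ⟨i, h⟩)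
    (hb : ∀ h : c i ≠ k, Measurable fun ω => b ω ⟨i, h⟩) :
    Measurable fun ω => assemble c k (a ω) (b ω) i := by
  by_cases h : c i = k
  · simpa only [assemble, dif_pos h] using ha h
  · simpa only [assemble, dif_neg h] using hb h

theorem measurable_assemble :
    Measurable fun p : (Block c k → ℝ) × (CoBlock c k → ℝ) => assemble c k p.1 p.2 :=
  measurable_pi_lambda _ fun i => measurable_assemble_comp c k i (fun _ => by fun_prop)
    (fun _ => by fun_prop)

theorem assemble_restrict (x : Fin d → ℝ) :
    assemble c k (fun i => x i) (fun i => x i) = x := by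
  funext i; by_cases h : c i = k <;> simp [assemble, h]

/-- The coordinates in the block. -/
abbrev blockCoord (i : Block c k) (p : (Block c k → ℝ) × (CoBlock c k → ℝ)) : ℝ := p.1 i

/-- The coordinates outside the block. -/
abbrev coBlockCoord (i : CoBlock c k) (p : (Block c k → ℝ) × (CoBlock c k → ℝ)) : ℝ := p.2 i

/-- All coordinates but the coordinate `j` of the block, which is replaced by a constant. -/
def otherCoords {c : Fin d → Fin K} {k : Fin K} (j : Block c k)
    (p : (Block c k → ℝ) × (CoBlock c k → ℝ)) : (Block c k → ℝ) × (CoBlock c k → ℝ) :=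
  (Function.update p.1 j 0, p.2)

theorem measurable_otherCoords {c : Fin d → Fin K} {k : Fin K} (j : Block c k) :
    Measurable (otherCoords j) := by
  unfold otherCoords; fun_prop

theorem measurable_blockCoord (i : Block c k) : Measurable (blockCoord c k i) :=
  (measurable_pi_apply i).comp measurable_fst

theorem measurable_coBlockCoord (i : CoBlock c k) : Measurable (coBlockCoord c k i) :=
  (measurable_pi_apply i).comp measurable_snd

theorem measurable_blockCoord_of_ne {i j : Block c k} (h : i ≠ j) :
    Measurable[MeasurableSpace.comap (otherCoords j) inferInstance] (blockCoord c k i) := by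
  have : blockCoord c k i = blockCoord c k i ∘ otherCoords j := by
    funext p; simp [otherCoords, blockCoord, Function.update_of_ne h]
  rw [this]
  exact (measurable_blockCoord c k i).comp (measurable_iff_comap_le.2 le_rfl)

theorem measurable_coBlockCoord_comap (i : CoBlock c k) (j : Block c k) :
    Measurable[MeasurableSpace.comap (otherCoords j) inferInstance] (coBlockCoord c k i) := by
  have : coBlockCoord c k i = coBlockCoord c k i ∘ otherCoords j := rfl
  rw [this]
  exact (measurable_coBlockCoord c k i).comp (measurable_iff_comap_le.2 le_rfl)

theorem measurable_otherCoords_comp {Ω : Type*} {m : MeasurableSpace Ω} {j : Block c k}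
    {z : Ω → (Block c k → ℝ) × (CoBlock c k → ℝ)}
    (hb : ∀ i, i ≠ j → Measurable fun ω => blockCoord c k i (z ω))
    (hc : ∀ i, Measurable fun ω => coBlockCoord c k i (z ω)) :
    Measurable fun ω => otherCoords j (z ω) := by
  refine Measurable.prodMk (measurable_pi_lambda _ fun i => ?_) (measurable_pi_lambda _ hc)
  by_cases hi : i = j
  · subst hi; simp
  · simpa only [Function.update_of_ne hi] using hb i hi

theorem comap_otherCoords_le (j : Block c k) :
    MeasurableSpace.comap (otherCoords j) inferInstance ≤
      familySigma (blockCoord c k) {j}ᶜ ⊔ familySigma (coBlockCoord c k) Set.univ :=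
  measurable_iff_comap_le.1 <| measurable_otherCoords_comp c k (z := id)
    (fun _ hi => measurable_of_familySigma_le (f := blockCoord c k) (S := {j}ᶜ) le_sup_left hi)
    (fun i => measurable_of_familySigma_le (f := coBlockCoord c k) le_sup_right (Set.mem_univ i))

variable {Ω : Type*} [MeasurableSpace Ω] {μ : Measure Ω} {X : Fin d → Ω → ℝ}

theorem indepFun_block_coBlock (hX : ∀ i, Measurable (X i))
    (h_blocks : iIndepFun (fun (k : Fin K) (ω : Ω) (i : Block c k) => X i ω) μ) :
    IndepFun (fun ω (i : Block c k) => X i ω) (fun ω (i : CoBlock c k) => X i ω) μ := by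
  have h := h_blocks.indepFun_finset {k} (Finset.univ.erase k) (by simp)
    (fun k => measurable_pi_lambda _ fun i => hX i)
  have hφ : Measurable fun (f : (l : ({k} : Finset (Fin K))) → Block c l.1 → ℝ) =>
      f ⟨k, Finset.mem_singleton_self k⟩ := measurable_pi_apply _
  have hψ : Measurable fun (f : (l : Finset.univ.erase k) → Block c l.1 → ℝ) (i : CoBlock c k) =>
      f ⟨c i, Finset.mem_erase.2 ⟨i.2, Finset.mem_univ _⟩⟩ ⟨i, rfl⟩ := by fun_prop
  exact h.comp hφ hψ

variable [IsProbabilityMeasure μ]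

/-- Both variances are computed under the common law of the inputs, where the conditioning is on
coordinates. This allows the Shapley increments to be evaluated on the argument space of a
dependency model. -/
theorem variance_condOutput (hX : ∀ i, Measurable (X i)) {M : (Fin d → ℝ) → ℝ}
    {Ω' : Type*} {mΩ' : MeasurableSpace Ω'} {P : Measure Ω'} [IsProbabilityMeasure P]
    {X' : Fin d → Ω' → ℝ} (hX' : ∀ i, Measurable (X' i))
    (hlaw : P.map (fun ω i => X' i ω) = μ.map (fun ω i => X i ω))
    (hM : Measurable M) (hM_sq : MemLp (output X M) 2 μ) (U : Finset (Fin d)) :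
    variance (condOutput μ X M U) μ =
      variance (P[fun ω => M fun i => X' i ω | familySigma X' ↑U]) P := by
  have hXm : Measurable fun ω i => X i ω := measurable_pi_lambda _ hX
  have hXm' : Measurable fun ω i => X' i ω := measurable_pi_lambda _ hX'
  have hi : Integrable M (μ.map fun ω i => X i ω) :=
    (integrable_map_measure hM.aestronglyMeasurable hXm.aemeasurable).2
      (hM_sq.integrable one_le_two)
  set m : MeasurableSpace (Fin d → ℝ) := familySigma (fun i x => x i) ↑U with hm
  have hle : m ≤ MeasurableSpace.pi := familySigma_le_iff.2 fun i _ => measurable_pi_apply i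
  have h1 := variance_condExp_map hXm hle hi
  have h2 := variance_condExp_map hXm' hle (hlaw ▸ hi)
  rw [hlaw, h1, hm, comap_familySigma, comap_familySigma] at h2
  rw [condOutput, comap_subtype_eq_familySigma]
  exact h2

end Blocks

/-! ### Sandwiching the Shapley increments by means of a dependency model. -/

namespace DependencyModel

variable {Ω : Type*} [MeasurableSpace Ω] {μ : Measure Ω} {d K : ℕ}
  {X : Fin d → Ω → ℝ} {c : Fin d → Fin K} {k : Fin K} {u : Finset (Block c k)} {j : Block c k}
  (D : DependencyModel (blockLaw μ X c k) u j)

/-- The inputs, as functions of the arguments of the equivalent representation. -/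
def modelInput (i : Fin d) (p : (Block c k → ℝ) × (CoBlock c k → ℝ)) : ℝ :=
  assemble c k (D.represent p.1) p.2 i

/-- The inputs of the block, as functions of the arguments of the equivalent representation. -/
def blockInput (i : Block c k) (p : (Block c k → ℝ) × (CoBlock c k → ℝ)) : ℝ :=
  D.represent p.1 i

theorem measurable_blockInput_of {m : MeasurableSpace ((Block c k → ℝ) × (CoBlock c k → ℝ))}
    (i : Block c k) (h : ∀ l, D.w.symm l ≤ D.w.symm i →
      Measurable (D.blockInput l) ∨ Measurable (blockCoord c k l)) :
    Measurable (D.blockInput i) :=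
  D.measurable_represent_comp (z := Prod.fst) i h

theorem measurable_represent : Measurable D.represent :=
  measurable_pi_lambda _ fun i =>
    D.measurable_represent_comp (z := id) i fun l _ => Or.inr (measurable_pi_apply l)

theorem measurable_modelInput_of {m : MeasurableSpace ((Block c k → ℝ) × (CoBlock c k → ℝ))}
    (i : Fin d) (hb : ∀ h : c i = k, Measurable (D.blockInput ⟨i, h⟩))
    (hc : ∀ h : c i ≠ k, Measurable (coBlockCoord c k ⟨i, h⟩)) : Measurable (D.modelInput i) :=
  measurable_assemble_comp c k i hb hc

theorem measurable_modelInput (i : Fin d) : Measurable (D.modelInput i) :=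
  measurable_assemble_comp c k i
    (fun _ => (measurable_pi_apply _).comp (D.measurable_represent.comp measurable_fst))
    (fun _ => (measurable_pi_apply _).comp measurable_snd)

variable [IsProbabilityMeasure μ]

theorem isProbabilityMeasure_argLaw (hX : ∀ i, Measurable (X i)) :
    IsProbabilityMeasure D.argLaw := by
  have := D.isProbabilityMeasure_input
  have : IsProbabilityMeasure (coBlockLaw μ X c k) :=
    Measure.isProbabilityMeasure_map (measurable_pi_lambda (fun ω (i : CoBlock c k) => X i ω) fun i => hX i).aemeasurable
  unfold argLaw
  infer_instance

/-- The model reproduces the law of the block, and independence of the blocks makes the joint law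
the product of the block law and the law of the rest. -/
theorem map_modelInput (hX : ∀ i, Measurable (X i))
    (h_blocks : iIndepFun (fun (k : Fin K) (ω : Ω) (i : Block c k) => X i ω) μ) :
    D.argLaw.map (fun p i => D.modelInput i p) = μ.map (fun ω i => X i ω) := by
  have := D.isProbabilityMeasure_input
  have hb : Measurable fun ω (i : Block c k) => X i ω := measurable_pi_lambda _ fun i => hX i
  have hc : Measurable fun ω (i : CoBlock c k) => X i ω := measurable_pi_lambda _ fun i => hX i
  have : IsProbabilityMeasure (coBlockLaw μ X c k) :=
    Measure.isProbabilityMeasure_map hc.aemeasurable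
  have h1 : D.argLaw.map (Prod.map D.represent id) =
      (blockLaw μ X c k).prod (coBlockLaw μ X c k) := by
    rw [argLaw, ← Measure.map_prod_map _ _ D.measurable_represent measurable_id, Measure.map_id,
      D.map_represent]
  have h2 := (indepFun_block_coBlock c k hX h_blocks).map_prod_eq_prod_map_map hb.aemeasurable
    hc.aemeasurable
  have h3 : (fun p i => D.modelInput i p) =
      (fun p : (Block c k → ℝ) × (CoBlock c k → ℝ) => assemble c k p.1 p.2) ∘
        Prod.map D.represent id := rfl
  rw [h3, ← Measure.map_map (measurable_assemble c k)
    (D.measurable_represent.prodMap measurable_id), h1, blockLaw, coBlockLaw, ← h2,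
    Measure.map_map (measurable_assemble c k) (hb.prodMk hc)]
  congr 1
  funext ω
  exact assemble_restrict c k fun i => X i ω

theorem memLp_equivRep (hX : ∀ i, Measurable (X i))
    (h_blocks : iIndepFun (fun (k : Fin K) (ω : Ω) (i : Block c k) => X i ω) μ)
    {M : (Fin d → ℝ) → ℝ} (hM : Measurable M) (hM_sq : MemLp (output X M) 2 μ) :
    MemLp (D.equivRep M) 2 D.argLaw := by
  have h1 : MemLp M 2 (μ.map fun ω i => X i ω) :=
    (memLp_map_measure_iff hM.aestronglyMeasurable
      (measurable_pi_lambda _ hX).aemeasurable).2 hM_sq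
  rw [← D.map_modelInput hX h_blocks] at h1
  exact (memLp_map_measure_iff hM.aestronglyMeasurable
    (measurable_pi_lambda _ D.measurable_modelInput).aemeasurable).1 h1

omit [IsProbabilityMeasure μ] in
theorem measurable_equivRep_of {m : MeasurableSpace ((Block c k → ℝ) × (CoBlock c k → ℝ))}
    (h : ∀ i, Measurable (D.modelInput i)) {M : (Fin d → ℝ) → ℝ} (hM : Measurable M) :
    Measurable (D.equivRep M) :=
  hM.comp (measurable_pi_lambda _ h)

omit [IsProbabilityMeasure μ] in
theorem measurable_equivRep {M : (Fin d → ℝ) → ℝ} (hM : Measurable M) :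
    Measurable (D.equivRep M) :=
  D.measurable_equivRep_of D.measurable_modelInput hM

theorem map_fst_argLaw (hX : ∀ i, Measurable (X i)) :
    D.argLaw.map Prod.fst = Measure.pi D.input := by
  have := D.isProbabilityMeasure_input
  have : IsProbabilityMeasure (coBlockLaw μ X c k) := Measure.isProbabilityMeasure_map
    (measurable_pi_lambda (fun ω (i : CoBlock c k) => X i ω) fun i => hX i).aemeasurable
  rw [argLaw, Measure.map_fst_prod, measure_univ, one_smul]

theorem map_blockCoord (hX : ∀ i, Measurable (X i)) (i : Block c k) :
    D.argLaw.map (blockCoord c k i) = D.input i := by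
  have := D.isProbabilityMeasure_input
  rw [← (measurePreserving_eval D.input i).map_eq, ← D.map_fst_argLaw hX,
    Measure.map_map (measurable_pi_apply i) measurable_fst]
  rfl

theorem indep_argLaw (hX : ∀ i, Measurable (X i)) (S : Set (Block c k)) :
    Indep (familySigma (blockCoord c k) S)
      (familySigma (blockCoord c k) Sᶜ ⊔ familySigma (coBlockCoord c k) Set.univ) D.argLaw := by
  have := D.isProbabilityMeasure_input
  have : IsProbabilityMeasure (coBlockLaw μ X c k) :=
    Measure.isProbabilityMeasure_map (measurable_pi_lambda (fun ω (i : CoBlock c k) => X i ω) fun i => hX i).aemeasurable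
  have := D.isProbabilityMeasure_argLaw hX
  refine indep_familySigma_compl_sup (fun i => (measurable_pi_apply i).comp measurable_fst) ?_
    (familySigma_le_iff.2 fun i _ => (measurable_pi_apply i).comp measurable_snd) ?_ S
  · rw [iIndepFun_iff_map_fun_eq_pi_map
      fun i => ((measurable_pi_apply i).comp measurable_fst).aemeasurable]
    have h : (fun i => D.argLaw.map (blockCoord c k i)) = D.input := funext (D.map_blockCoord hX)
    exact (D.map_fst_argLaw hX).trans (congrArg Measure.pi h.symm)
  · have h : IndepFun (fun p : (Block c k → ℝ) × (CoBlock c k → ℝ) => p.1) (fun p => p.2)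
        D.argLaw := indepFun_prod measurable_id measurable_id
    exact indep_of_indep_of_le ((IndepFun_iff_Indep _ _ _).1 h) familySigma_le_comap
      familySigma_le_comap

variable {U : Finset (Fin d)}

omit [IsProbabilityMeasure μ] in
theorem mem_iff_lt (hU : ∀ i : Block c k, (i : Fin d) ∈ U ↔ i ∈ u) (i : Block c k) :
    (i : Fin d) ∈ U ↔ D.w.symm i < D.w.symm j :=
  (hU i).trans (D.mem_iff i)

omit [IsProbabilityMeasure μ] in
theorem mem_insert_iff_le (hU : ∀ i : Block c k, (i : Fin d) ∈ U ↔ i ∈ u) (i : Block c k) :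
    (i : Fin d) ∈ insert (j : Fin d) U ↔ D.w.symm i ≤ D.w.symm j := by
  rw [Finset.mem_insert, D.mem_iff_lt hU, le_iff_lt_or_eq, or_comm, D.w.symm.injective.eq_iff,
    Subtype.ext_iff]

omit [IsProbabilityMeasure μ] in
theorem modelInput_block (i : Block c k) : D.modelInput i = D.blockInput i := by
  funext p; simp [modelInput, blockInput, assemble, i.2]

omit [IsProbabilityMeasure μ] in
theorem modelInput_coBlock (i : CoBlock c k) : D.modelInput i = coBlockCoord c k i := by
  funext p; simp [modelInput, assemble, i.2]

omit [IsProbabilityMeasure μ] in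
-- The block inputs in `U` come before `j` in the permutation, so generating them never uses the
-- innovation of `j`.
theorem familySigma_modelInput_le (hU : ∀ i : Block c k, (i : Fin d) ∈ U ↔ i ∈ u) :
    familySigma D.modelInput ↑U ≤ MeasurableSpace.comap (otherCoords j) inferInstance := by
  refine familySigma_le_iff.2 fun i hi => D.measurable_modelInput_of i (fun h => ?_)
    (fun h => measurable_coBlockCoord_comap c k ⟨i, h⟩ j)
  refine D.measurable_blockInput_of ⟨i, h⟩ fun l hl =>
    Or.inr (measurable_blockCoord_of_ne c k ?_)
  rintro rfl
  exact absurd ((D.mem_iff_lt hU ⟨i, h⟩).1 hi) (not_lt.2 hl)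

theorem indep_blockCoord_otherCoords (hX : ∀ i, Measurable (X i)) :
    IndepFun (blockCoord c k j) (otherCoords j) D.argLaw := by
  have h := D.indep_argLaw hX {j}
  rw [familySigma_singleton] at h
  exact (IndepFun_iff_Indep _ _ _).2 (indep_of_indep_of_le_right h (comap_otherCoords_le c k j))

/-- Conditionally on the inputs in `U`, the innovation `j` and the input `j` carry the same
information on the output. -/
theorem condExp_blockCoord_sup (hX : ∀ i, Measurable (X i)) {M : (Fin d → ℝ) → ℝ}
    (hM : Measurable M) (hint : Integrable (D.equivRep M) D.argLaw)
    (hU : ∀ i : Block c k, (i : Fin d) ∈ U ↔ i ∈ u) :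
    D.argLaw[D.equivRep M | MeasurableSpace.comap (blockCoord c k j) inferInstance ⊔
      familySigma D.modelInput ↑U] =ᵐ[D.argLaw]
      D.argLaw[D.equivRep M | familySigma D.modelInput ↑(insert (j : Fin d) U)] := by
  have := D.isProbabilityMeasure_argLaw hX
  have hbm := measurable_blockCoord c k
  have hcm := measurable_coBlockCoord c k
  have hUlt := D.mem_iff_lt hU
  have hUle := D.mem_insert_iff_le hU
  have hrep := D.modelInput_block
  have hout := D.modelInput_coBlock
  set S : Set (Block c k) := {i | D.w.symm i ≤ D.w.symm j} with hS
  have hSU : ∀ i : Block c k, i ∈ S ↔ (i : Fin d) ∈ insert (j : Fin d) U := fun i => (hUle i).symm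
  have heq : familySigma D.blockInput S ⊔
      familySigma (coBlockCoord c k) {i | (i : Fin d) ∈ U} =
      familySigma D.modelInput ↑(insert (j : Fin d) U) := by
    refine le_antisymm (sup_le (familySigma_le_iff.2 fun i hi => ?_)
      (familySigma_le_iff.2 fun i hi => ?_)) (familySigma_le_iff.2 fun i hi => ?_)
    · rw [← hrep i]
      exact measurable_familySigma ((hSU i).1 hi)
    · rw [← hout i]
      exact measurable_familySigma (Finset.mem_coe.2 (Finset.mem_insert_of_mem hi))
    · rw [Finset.mem_coe] at hi
      refine D.measurable_modelInput_of i (fun h => ?_) (fun h => ?_)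
      · have hiS : (⟨i, h⟩ : Block c k) ∈ S := (hSU ⟨i, h⟩).2 hi
        exact measurable_of_familySigma_le (f := D.blockInput) le_sup_left hiS
      · refine measurable_of_familySigma_le (f := coBlockCoord c k) (i := ⟨i, h⟩) le_sup_right ?_
        refine (Finset.mem_insert.1 hi).resolve_left ?_
        rintro rfl
        exact h j.2
  have hA'A : familySigma D.blockInput S ≤ familySigma (blockCoord c k) S :=
    familySigma_le_iff.2 fun i hi => D.measurable_blockInput_of i fun l hl =>
      Or.inr (measurable_familySigma (f := blockCoord c k) (hl.trans hi))
  -- The output is a function of the block inputs up to `j`, the later innovations and the inputs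
  -- outside the block: the innovations up to `j` enter only through the inputs they generate.
  have hg : StronglyMeasurable[familySigma D.blockInput S ⊔
      (familySigma (blockCoord c k) Sᶜ ⊔ familySigma (coBlockCoord c k) Set.univ)]
      (D.equivRep M) := by
    refine Measurable.stronglyMeasurable (D.measurable_equivRep_of (fun i =>
      D.measurable_modelInput_of i (fun h => ?_) (fun h => ?_)) hM)
    · refine D.measurable_blockInput_of ⟨i, h⟩ fun l _ => ?_
      by_cases hl : l ∈ S
      · exact Or.inl (measurable_of_familySigma_le (f := D.blockInput)
          le_sup_left hl)
      · exact Or.inr (measurable_of_familySigma_le (f := blockCoord c k) (S := Sᶜ)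
          (le_sup_left.trans le_sup_right) hl)
    · exact measurable_of_familySigma_le (f := coBlockCoord c k)
        (le_sup_right.trans le_sup_right) (Set.mem_univ (⟨i, h⟩ : CoBlock c k))
  have h1 := condExp_sup_eq_of_indep (C' := familySigma (coBlockCoord c k) {i | (i : Fin d) ∈ U})
    (familySigma_le_iff.2 fun i _ => hbm i)
    (sup_le (familySigma_le_iff.2 fun i _ => hbm i) (familySigma_le_iff.2 fun i _ => hcm i))
    hA'A ((familySigma_mono (Set.subset_univ _)).trans le_sup_right) (D.indep_argLaw hX S) hg hint
  rw [heq] at h1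
  have hjS : j ∈ S := le_refl (D.w.symm j)
  -- `hle1` and `hle2` place `σ(Z_j) ⊔ σ(X_U)` between `σ(X_{U ∪ {j}})` and the σ-algebra of the
  -- innovations up to `j` and the outside inputs in `U`. By `h1` the two extremes give the same
  -- conditional expectation of the output, hence so does the middle one.
  have hle1 : MeasurableSpace.comap (blockCoord c k j) inferInstance ⊔
      familySigma D.modelInput ↑U ≤ familySigma (blockCoord c k) S ⊔
      familySigma (coBlockCoord c k) {i | (i : Fin d) ∈ U} := by
    refine sup_le ?_ ?_
    · rw [← familySigma_singleton]
      exact (familySigma_mono (Set.singleton_subset_iff.2 hjS)).trans le_sup_left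
    · refine (familySigma_mono ?_).trans (heq.ge.trans (sup_le_sup_right hA'A _))
      exact Finset.coe_subset.2 (Finset.subset_insert _ _)
  have hle2 : familySigma D.modelInput ↑(insert (j : Fin d) U) ≤
      MeasurableSpace.comap (blockCoord c k j) inferInstance ⊔ familySigma D.modelInput ↑U := by
    rw [Finset.coe_insert, familySigma_insert]
    refine sup_le (measurable_iff_comap_le.1 ?_) le_sup_right
    rw [hrep]
    refine D.measurable_blockInput_of j fun l hl => ?_
    rcases hl.lt_or_eq with hl | hl
    · left
      rw [← hrep l]
      exact measurable_of_familySigma_le le_sup_right (Finset.mem_coe.2 ((hUlt l).2 hl))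
    · right
      rw [D.w.symm.injective hl]
      exact (measurable_iff_comap_le.2 le_rfl : Measurable[MeasurableSpace.comap
        (blockCoord c k j) inferInstance] (blockCoord c k j)).mono le_sup_left le_rfl
  have hle3 : familySigma (blockCoord c k) S ⊔
      familySigma (coBlockCoord c k) {i | (i : Fin d) ∈ U} ≤ Prod.instMeasurableSpace :=
    sup_le (familySigma_le_iff.2 fun i _ => hbm i) (familySigma_le_iff.2 fun i _ => hcm i)
  calc _ =ᵐ[D.argLaw] _ := (condExp_condExp_of_le hle1 hle3).symm
    _ =ᵐ[D.argLaw] _ := condExp_congr_ae h1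
    _ = _ := condExp_of_stronglyMeasurable (hle1.trans hle3)
      (stronglyMeasurable_condExp.mono hle2) integrable_condExp

theorem totFunctional_ae_eq (hX : ∀ i, Measurable (X i)) {M : (Fin d → ℝ) → ℝ}
    (hM : Measurable M) (hint : Integrable (D.equivRep M) D.argLaw) :
    D.totFunctional M =ᵐ[D.argLaw] D.equivRep M -
      D.argLaw[D.equivRep M | MeasurableSpace.comap (otherCoords j) inferInstance] := by
  have := D.isProbabilityMeasure_argLaw hX
  have hΦ : Measurable fun q : ((Block c k → ℝ) × (CoBlock c k → ℝ)) × ℝ =>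
      D.equivRep M (Function.update q.1.1 j q.2, q.1.2) := by
    refine (D.measurable_equivRep hM).comp (Measurable.prodMk ?_ (by fun_prop))
    exact measurable_update'.comp (Measurable.prodMk (by fun_prop) (by fun_prop))
  have hY : ∀ p t, Function.update (otherCoords j p).1 j t = Function.update p.1 j t := by
    intro p t; simp [otherCoords]
  have hg : ∀ p, D.equivRep M (Function.update (otherCoords j p).1 j (blockCoord c k j p),
      (otherCoords j p).2) = D.equivRep M p := by
    intro p; rw [hY, blockCoord, Function.update_eq_self]; rfl
  have h := condExp_eq_integral_of_indepFun (measurable_otherCoords j)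
    (measurable_blockCoord c k j) (D.indep_blockCoord_otherCoords hX) hΦ
    (hint.congr (.of_forall fun p => (hg p).symm))
  simp only [hg] at h
  rw [D.map_blockCoord hX] at h
  simp only [hY] at h
  exact (ae_eq_refl _).sub h.symm

/-- The Shapley increments, for coalitions with trace `u` on the block, lie between the first-order
and the total sensitivity of the input `j` of the dependency model. -/
theorem sigmaFo_le_and_le_sigmaTot (hX : ∀ i, Measurable (X i))
    (h_blocks : iIndepFun (fun (k : Fin K) (ω : Ω) (i : Block c k) => X i ω) μ)
    {M : (Fin d → ℝ) → ℝ} (hM : Measurable M) (hM_sq : MemLp (output X M) 2 μ)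
    (hU : ∀ i : Block c k, (i : Fin d) ∈ U ↔ i ∈ u) :
    D.sigmaFo M ≤
        variance (condOutput μ X M (insert (j : Fin d) U)) μ - variance (condOutput μ X M U) μ ∧
      variance (condOutput μ X M (insert (j : Fin d) U)) μ - variance (condOutput μ X M U) μ ≤
        D.sigmaTot M := by
  have := D.isProbabilityMeasure_argLaw hX
  have hmem := D.memLp_equivRep hX h_blocks hM hM_sq
  have hint : Integrable (D.equivRep M) D.argLaw := hmem.integrable one_le_two
  have hlaw := D.map_modelInput hX h_blocks
  rw [variance_condOutput hX D.measurable_modelInput hlaw hM hM_sq,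
    variance_condOutput hX D.measurable_modelInput hlaw hM hM_sq]
  have main := variance_condExp_sup_sub_mem (measurable_blockCoord c k j).comap_le
    (measurable_otherCoords j).comap_le (D.familySigma_modelInput_le hU)
    ((IndepFun_iff_Indep _ _ _).1 (D.indep_blockCoord_otherCoords hX)) hmem
  have hfo : D.sigmaFo M = variance (D.argLaw[D.equivRep M |
      MeasurableSpace.comap (blockCoord c k j) inferInstance]) D.argLaw :=
    variance_sub_const integrable_condExp.aestronglyMeasurable _
  rw [variance_congr (D.condExp_blockCoord_sup hX hM hint hU),
    ← variance_congr (D.totFunctional_ae_eq hX hM hint), ← hfo] at main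
  exact main

end DependencyModel

/-! ### Sandwiching the Shapley increments of an independent input. -/

section IndependentBlock

variable {Ω : Type*} {mΩ : MeasurableSpace Ω} {μ : Measure Ω} [IsProbabilityMeasure μ]
  {d K : ℕ} [NeZero K] {X : Fin d → Ω → ℝ} {c : Fin d → Fin K}

omit [NeZero K] in
theorem measurable_update_zero_of {m : MeasurableSpace Ω} {j : Fin d}
    (h : ∀ i, i ≠ j → Measurable (X i)) :
    Measurable fun ω => Function.update (fun i => X i ω) j 0 := by
  refine measurable_pi_lambda _ fun i => ?_
  by_cases hi : i = j
  · subst hi; simp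
  · simpa only [Function.update_of_ne hi] using h i hi

theorem indepFun_update_zero (hX : ∀ i, Measurable (X i))
    (h_blocks : iIndepFun (fun (k : Fin K) (ω : Ω) (i : Block c k) => X i ω) μ)
    (h_indep : iIndepFun (fun (i : Block c (0 : Fin K)) (ω : Ω) => X i ω) μ)
    {j : Fin d} (hj : c j = 0) :
    IndepFun (X j) (fun ω => Function.update (fun i => X i ω) j 0) μ := by
  set f : Block c (0 : Fin K) → Ω → ℝ := fun i => X i with hf
  set g : CoBlock c (0 : Fin K) → Ω → ℝ := fun i => X i with hg
  have hle : familySigma g Set.univ ≤ mΩ := familySigma_le_iff.2 fun i _ => hX i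
  have hfg : Indep (familySigma f Set.univ) (familySigma g Set.univ) μ :=
    indep_of_indep_of_le ((IndepFun_iff_Indep _ _ _).1 (indepFun_block_coBlock c 0 hX h_blocks))
      familySigma_le_comap familySigma_le_comap
  have h := indep_familySigma_compl_sup (f := f) (fun i => hX i) h_indep hle hfg {⟨j, hj⟩}
  rw [familySigma_singleton] at h
  refine (IndepFun_iff_Indep _ _ _).2 (indep_of_indep_of_le_right h ?_)
  refine measurable_iff_comap_le.1 (measurable_update_zero_of fun i hi => ?_)
  by_cases hc : c i = 0
  · refine measurable_of_familySigma_le (f := f) (i := ⟨i, hc⟩) le_sup_left ?_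
    exact fun h' => hi (Subtype.ext_iff.1 h')
  · exact measurable_of_familySigma_le (f := g) (i := ⟨i, hc⟩) le_sup_right (Set.mem_univ _)

/-- No dependency model is needed: `variance_condExp_sup_sub_mem` applies with `Z`, `B`, `C`
generated by `X j`, by the inputs in `U`, and by all inputs but `j`. Neither bound depends on `U`.
-/
theorem variance_condOutput_insert_mem (hX : ∀ i, Measurable (X i))
    {M : (Fin d → ℝ) → ℝ} (hM : Measurable M) (hM_sq : MemLp (output X M) 2 μ) {j : Fin d}
    (hind : IndepFun (X j) (fun ω => Function.update (fun i => X i ω) j 0) μ)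
    {U : Finset (Fin d)} (hjU : j ∉ U) :
    variance (fun ω => condOutput μ X M {j} ω - ∫ ω', output X M ω' ∂μ) μ ≤
        variance (condOutput μ X M (insert j U)) μ - variance (condOutput μ X M U) μ ∧
      variance (condOutput μ X M (insert j U)) μ - variance (condOutput μ X M U) μ ≤
        variance (fun ω => output X M ω -
          ∫ t, M (Function.update (fun i => X i ω) j t) ∂(μ.map (X j))) μ := by
  set Y : Ω → Fin d → ℝ := fun ω => Function.update (fun i => X i ω) j 0 with hYdef
  have hY : Measurable Y := measurable_update_zero_of fun i _ => hX i
  have hU : familySigma X ↑U ≤ MeasurableSpace.comap Y inferInstance := by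
    refine familySigma_le_iff.2 fun i hi => ?_
    have hij : i ≠ j := by rintro rfl; exact hjU hi
    have : X i = (fun x : Fin d → ℝ => x i) ∘ Y := by
      funext ω; simp [hYdef, Function.update_of_ne hij]
    rw [this]
    exact (measurable_pi_apply i).comp (measurable_iff_comap_le.2 le_rfl)
  have main := variance_condExp_sup_sub_mem (hX j).comap_le hY.comap_le hU
    ((IndepFun_iff_Indep _ _ _).1 hind) hM_sq
  have hΦ : Measurable fun q : (Fin d → ℝ) × ℝ => M (Function.update q.1 j q.2) :=
    hM.comp measurable_update'
  have hY' : ∀ ω t, Function.update (Y ω) j t = Function.update (fun i => X i ω) j t := by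
    intro ω t; simp [hYdef]
  have hg : ∀ ω, M (Function.update (Y ω) j (X j ω)) = output X M ω := by
    intro ω; rw [hY', Function.update_eq_self]; rfl
  have h := condExp_eq_integral_of_indepFun hY (hX j) hind hΦ
    ((hM_sq.integrable one_le_two).congr (.of_forall fun ω => (hg ω).symm))
  simp only [hg] at h
  simp only [hY'] at h
  have htot : (fun ω => output X M ω -
      ∫ t, M (Function.update (fun i => X i ω) j t) ∂(μ.map (X j))) =ᵐ[μ]
      output X M - μ[output X M | MeasurableSpace.comap Y inferInstance] :=
    (ae_eq_refl _).sub h.symm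
  have hcond : ∀ V, condOutput μ X M V = μ[output X M | familySigma X ↑V] := by
    intro V; rw [condOutput, comap_subtype_eq_familySigma]
  rw [variance_sub_const (by rw [hcond]; exact integrable_condExp.aestronglyMeasurable),
    variance_congr htot, hcond, hcond, hcond, Finset.coe_insert, familySigma_insert,
    Finset.coe_singleton, familySigma_singleton]
  exact main

end IndependentBlock

/-! ### Averaging the bounds over coalitions. -/

theorem mainTheorem1 {Ω : Type*} [MeasurableSpace Ω] (μ : Measure Ω) [IsProbabilityMeasure μ]
    {d K : ℕ} [NeZero K] (X : Fin d → Ω → ℝ) (hX : ∀ i, Measurable (X i))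
    (c : Fin d → Fin K)
    (h_blocks : iIndepFun (fun (k : Fin K) (ω : Ω) (i : Block c k) => X i ω) μ)
    (h_indep : iIndepFun (fun (i : Block c (0 : Fin K)) (ω : Ω) => X i ω) μ)
    (M : (Fin d → ℝ) → ℝ) (hM : Measurable M) (hM_sq : MemLp (output X M) 2 μ)
    (hM_var : variance (output X M) μ ≠ 0)
    (D : DependencyModels μ X c) (j : Fin d) :
    mainDSI μ X M c D j ≤ shapleyEffect μ X M j ∧
      shapleyEffect μ X M j ≤ totalDSI μ X M c D j := by
  have hpos : 0 < variance (output X M) μ := (variance_nonneg _ _).lt_of_ne' hM_var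
  have hweight : ∀ (n : ℕ) {ι : Type} (s : Finset ι) (a : ι → ℕ) (F : ι → ℝ),
      1 / (n * variance (output X M) μ) * ∑ i ∈ s, ((n - 1).choose (a i) : ℝ)⁻¹ * F i =
      (∑ i ∈ s, shapleyWeight n (a i) * F i) / variance (output X M) μ := by
    intro n ι s a F
    rw [Finset.mul_sum, Finset.sum_div]
    refine Finset.sum_congr rfl fun i _ => ?_
    rw [shapleyWeight, one_div, mul_inv, div_eq_mul_inv]
    ring
  have hsh : shapleyEffect μ X M j = (∑ U ∈ (Finset.univ.erase j).powerset,
      shapleyWeight d U.card * (variance (condOutput μ X M (insert j U)) μ -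
        variance (condOutput μ X M U) μ)) / variance (output X M) μ :=
    hweight d _ _ _
  have hnotMem : ∀ U ∈ (Finset.univ.erase j).powerset, j ∉ U := fun U hU h =>
    Finset.notMem_erase j _ (Finset.mem_powerset.1 hU h)
  rw [hsh]
  by_cases hj : c j = 0
  · have hb : ∀ U ∈ (Finset.univ.erase j).powerset, _ := fun U hU =>
      variance_condOutput_insert_mem hX hM hM_sq
        (indepFun_update_zero hX h_blocks h_indep hj) (hnotMem U hU)
    rw [mainDSI, totalDSI, dif_pos hj, dif_pos hj, div_le_div_iff_of_pos_right hpos,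
      div_le_div_iff_of_pos_right hpos]
    constructor
    -- The bound is the same for every `U`, so it is written as its own weighted average.
    · rw [← one_mul (variance (fun ω => condOutput μ X M {j} ω - _) μ), ← sum_shapleyWeight j,
        Finset.sum_mul]
      exact Finset.sum_le_sum fun U hU =>
        mul_le_mul_of_nonneg_left (hb U hU).1 (shapleyWeight_nonneg _ _)
    · rw [← one_mul (variance (fun ω => output X M ω - _) μ), ← sum_shapleyWeight j,
        Finset.sum_mul]
      exact Finset.sum_le_sum fun U hU =>
        mul_le_mul_of_nonneg_left (hb U hU).2 (shapleyWeight_nonneg _ _)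
  -- Each `U` is treated with the model chosen for its trace on the block of `j`.
  · have hb : ∀ (U : Finset (Fin d)) (hU : (⟨j, rfl⟩ : Block c (c j)) ∉
        U.subtype fun i => c i = c j), _ := fun U hU =>
      (D j hj ⟨U.subtype fun i => c i = c j, hU⟩).sigmaFo_le_and_le_sigmaTot hX h_blocks hM hM_sq
        (U := U) (fun i => by rw [Finset.mem_subtype])
    have hsub : ∀ U ∈ (Finset.univ.erase j).powerset, (⟨j, rfl⟩ : Block c (c j)) ∉
        U.subtype fun i => c i = c j := fun U hU h => hnotMem U hU (Finset.mem_subtype.1 h)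
    -- The default `0` only makes the summand total: by `hsub` no trace in the sum contains `j`.
    have hsum : ∀ G : {v : Finset (Block c (c j)) // (⟨j, rfl⟩ : Block c (c j)) ∉ v} → ℝ,
        ∑ v, shapleyWeight (Fintype.card (Block c (c j))) v.1.card * G v =
        ∑ U ∈ (Finset.univ.erase j).powerset, shapleyWeight d U.card *
          (if h : (⟨j, rfl⟩ : Block c (c j)) ∉ U.subtype fun i => c i = c j
            then G ⟨_, h⟩ else 0) := by
      intro G
      rw [sum_shapleyWeight_block c j fun v =>
        if h : (⟨j, rfl⟩ : Block c (c j)) ∉ v then G ⟨v, h⟩ else 0]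
      exact Finset.sum_congr rfl fun v _ => by rw [dif_pos v.2]
    rw [mainDSI, totalDSI, dif_neg hj, dif_neg hj, hweight, hweight, hsum, hsum,
      div_le_div_iff_of_pos_right hpos, div_le_div_iff_of_pos_right hpos]
    constructor
    · refine Finset.sum_le_sum fun U hU =>
        mul_le_mul_of_nonneg_left ?_ (shapleyWeight_nonneg _ _)
      rw [dif_pos (hsub U hU)]
      exact (hb U (hsub U hU)).1
    · refine Finset.sum_le_sum fun U hU =>
        mul_le_mul_of_nonneg_left ?_ (shapleyWeight_nonneg _ _)
      rw [dif_pos (hsub U hU)]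
      exact (hb U (hsub U hU)).2
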